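/- Consider eight parties $v_1,\dots,v_8$ with local dimensions $\boldsymbol d_0=(4,4,4,4,4,4,4,2)$, that is, with the total system $\overline{\mathcal H}=\bigotimes_{k=1}^8\overline{\mathcal H}^{v_k}$, $\dim\overline{\mathcal H}^{v_k}=4$ for $k\le 7$ and $\dim\overline{\mathcal H}^{v_8}=2$. Each $\overline{\mathcal H}^{v_k}$ contains a qubit $\mathcal H^{v_k}\cong\mathbb C^2$ as a subspace, and $\mathcal H=\bigotimes_k\mathcal H^{v_k}\subset\overline{\mathcal H}$. A state $|\phi\rangle\in\overline{\mathcal H}$ *consists of bipartite entanglement* if there are a simple graph on $\{v_1,\dots,v_8\}$ and, for each edge $e=\{v_k,v_l\}$, an entangled pure state $|\phi_e\rangle$ of a system at $v_k$ and a system at $v_l$, such that $|\phi\rangle$ is the image of $\bigotimes_e|\phi_e\rangle$ under a product of local isometries into the spaces $\overline{\mathcal H}^{v_k}$. It is a *common resource state* for a set $S$ of states of $\mathcal H$ if for each $|\psi\rangle\in S$ some LOCC protocol (with finitely or infinitely many rounds), in which party $v_k$ applies quantum instruments to $\overline{\mathcal H}^{v_k}$ without enlarging it, transforms $|\phi\rangle$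 into $|\psi\rangle$ deterministically and exactly. For a circuit $C$ of seven gates $\exp(\mathrm i\alpha_iZ\otimes Z)$, the $i$-th acting on two distinct qubits $v_{a_i},v_{b_i}$ of $\mathcal H$, let $$S_0(C)=\Bigl\{\prod_{i=1}^{7}\exp\bigl(\mathrm i\alpha_iZ^{v_{a_i}}\otimes Z^{v_{b_i}}\bigr)|+\rangle^{\otimes 8} : 0\le\alpha_i<2\pi\Bigr\},$$ and let $G(C)$ be the graph on $v_1,\dots,v_8$ with the edges $\{v_{a_i},v_{b_i}\}$. 1. For the circuit with gates on $v_1v_2,\ v_3v_4,\ v_5v_6,\ v_7v_8$, then $v_2v_4,\ v_6v_8$, then $v_4v_8$, no state of $\overline{\mathcal H}$ that consists of bipartite entanglement is a common resource state for $S_0(C)$. 2. The same holds for every such circuit $C$ for which $G(C)$ is connected (hence a tree) and the tree obtained from $G(C)$ by hanging a path with two edges on $v_8$ is not a caterpillar, i.e. has a vertex with three arms of length at least two. -/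

import Mathlib

noncomputable section

namespace BipartiteResource

open Filter Topology Matrix

/-! ## Multipartite systems -/

/-- Labels of the product basis of `⊗ₖ ℂ^(d k)`; a vector of that space is its family of
amplitudes `Conf d → ℂ`. -/
abbrev Conf {N : ℕ} (d : Fin N → ℕ) : Type := (k : Fin N) → Fin (d k)

/-- Unit vectors. -/
def IsState {ι : Type*} [Fintype ι] (φ : ι → ℂ) : Prop := ∑ x, ‖φ x‖ ^ 2 = 1

/-- The projector `|φ⟩⟨φ|`. -/
def density {ι : Type*} (φ : ι → ℂ) : Matrix ι ι ℂ := vecMulVec φ (star φ)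

/-- The operator `K` of party `k`, tensored with the identity on all other parties. -/
def localOp {N : ℕ} {d : Fin N → ℕ} (k : Fin N) (K : Matrix (Fin (d k)) (Fin (d k)) ℂ) :
    Matrix (Conf d) (Conf d) ℂ :=
  fun x y => if ∀ j, j ≠ k → x j = y j then K (x k) (y k) else 0

/-! ## LOCC within a configuration of local dimensions -/

/-- A finite LOCC protocol in which party `k` always holds a system of dimension `d k`.
In a step, party `k` applies a quantum instrument to its system: the classical outcome `i`
belongs to the completely positive map with Kraus operators `K i 0, K i 1, …`, and the sum over
all outcomes is trace preserving. The outcome is broadcast, and the continuation may depend on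
it. -/
inductive Protocol {N : ℕ} (d : Fin N → ℕ) : Type
  | done : Protocol d
  | step (k : Fin N) (m : ℕ) (r : Fin m → ℕ)
      (K : (i : Fin m) → Fin (r i) → Matrix (Fin (d k)) (Fin (d k)) ℂ)
      (tracePreserving : ∑ i, ∑ j, (K i j)ᴴ * K i j = 1)
      (next : Fin m → Protocol d) : Protocol d

/-- The output, averaged over all outcomes, of a protocol on an input density operator. -/
def Protocol.run {N : ℕ} {d : Fin N → ℕ} :
    Protocol d → Matrix (Conf d) (Conf d) ℂ → Matrix (Conf d) (Conf d) ℂ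
  | .done, ρ => ρ
  | .step k _ _ K _ next, ρ =>
      ∑ i, (next i).run (∑ j, localOp k (K i j) * ρ * (localOp k (K i j))ᴴ)

/-- `Extends P Q`: the protocol `Q` starts with `P` and possibly goes on after it. -/
inductive Protocol.Extends {N : ℕ} {d : Fin N → ℕ} : Protocol d → Protocol d → Prop
  | done (Q : Protocol d) : Protocol.Extends .done Q
  | step (k : Fin N) (m : ℕ) (r : Fin m → ℕ)
      (K : (i : Fin m) → Fin (r i) → Matrix (Fin (d k)) (Fin (d k)) ℂ)
      (h : ∑ i, ∑ j, (K i j)ᴴ * K i j = 1) (next next' : Fin m → Protocol d)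
      (hnext : ∀ i, Protocol.Extends (next i) (next' i)) :
      Protocol.Extends (.step k m r K h next) (.step k m r K h next')

/-- `φ` is transformed into `ψ` by LOCC, deterministically and exactly. A protocol may have
infinitely many rounds: it is given by longer and longer finite protocols, each of which continues
the preceding one, and its output is the limit of their outputs. A protocol with finitely many
rounds is a constant sequence, and its output then equals `|ψ⟩⟨ψ|`. -/
def LOCCTransforms {N : ℕ} {d : Fin N → ℕ} (φ ψ : Conf d → ℂ) : Prop :=
  ∃ P : ℕ → Protocol d, (∀ n, (P n).Extends (P (n + 1))) ∧
    Tendsto (fun n => (P n).run (density φ)) atTop (𝓝 (density ψ))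

/-- `φ` is a common resource state for the target set `S`. -/
def IsCommonResource {N : ℕ} {d : Fin N → ℕ} (φ : Conf d → ℂ) (S : Set (Conf d → ℂ)) : Prop :=
  ∀ ψ ∈ S, LOCCTransforms φ ψ

/-! ## States consisting of bipartite entanglement -/

/-- A distribution of bipartite entangled states among `N` parties along the edges of a graph.
`dim k l` is the dimension of the system at `k` that belongs to the state shared by `k` and `l`,
and the state of the edge `{k, l}` with `k < l` is `state k l`. The values of `dim` and `state` at
other pairs are not used. -/
structure Distribution (N : ℕ) where
  graph : SimpleGraph (Fin N)
  dim : Fin N → Fin N → ℕ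
  state : (k l : Fin N) → Fin (dim k l) → Fin (dim l k) → ℂ
  normalized : ∀ k l, k < l → graph.Adj k l → ∑ a, ∑ b, ‖state k l a b‖ ^ 2 = 1
  entangled : ∀ k l, k < l → graph.Adj k l →
    ¬ ∃ (f : Fin (dim k l) → ℂ) (g : Fin (dim l k) → ℂ), ∀ a b, state k l a b = f a * g b

namespace Distribution

/-- Basis labels of the systems that party `k` holds, one for each edge at `k`. -/
abbrev Local {N : ℕ} (D : Distribution N) (k : Fin N) : Type :=
  (l : {l : Fin N // D.graph.Adj k l}) → Fin (D.dim k l)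

/-- The edges, oriented from the smaller to the larger end. -/
abbrev Edge {N : ℕ} (D : Distribution N) : Type :=
  {p : Fin N × Fin N // p.1 < p.2 ∧ D.graph.Adj p.1 p.2}

open Classical in
/-- The tensor product of the states of all edges. -/
def amplitude {N : ℕ} (D : Distribution N) (y : (k : Fin N) → D.Local k) : ℂ :=
  ∏ e : D.Edge, D.state e.1.1 e.1.2 (y e.1.1 ⟨e.1.2, e.2.2⟩) (y e.1.2 ⟨e.1.1, e.2.2.symm⟩)

end Distribution

open Classical in
/-- `φ` is, up to a local isometry at each party (an embedding into the party's system followed by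
a local unitary), a tensor product of bipartite entangled states along the edges of a graph. -/
def ConsistsOfBipartite {N : ℕ} {d : Fin N → ℕ} (φ : Conf d → ℂ) : Prop :=
  ∃ (D : Distribution N) (W : (k : Fin N) → Matrix (Fin (d k)) (D.Local k) ℂ),
    (∀ k, (W k)ᴴ * W k = 1) ∧
    ∀ x, φ x = ∑ y : ((k : Fin N) → D.Local k), (∏ k, W k (x k) (y k)) * D.amplitude y

/-! ## The configuration and the target sets -/

/-- Eight parties; the last one holds one qubit, the others have dimension four. -/
def d₀ : Fin 8 → ℕ := ![4, 4, 4, 4, 4, 4, 4, 2]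

/-- The basis labels of eight qubits. -/
abbrev Qubits : Type := Conf (fun _ : Fin 8 => 2)

/-- The placement of seven two-qubit gates on eight wires. -/
structure Circuit where
  fst : Fin 7 → Fin 8
  snd : Fin 7 → Fin 8
  ne : ∀ i, fst i ≠ snd i

/-- The Pauli operator `Z`. -/
def pauliZ : Matrix (Fin 2) (Fin 2) ℂ := !![1, 0; 0, -1]

/-- `|+⟩^{⊗8}`. -/
def plus : Qubits → ℂ := fun _ => ∏ _k : Fin 8, ((1 / Real.sqrt 2 : ℝ) : ℂ)

/-- The gate `exp(i t Z ⊗ Z)` on the wires `a` and `b`. -/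
def zzGate (a b : Fin 8) (t : ℝ) : Matrix Qubits Qubits ℂ :=
  NormedSpace.exp ((Complex.I * (t : ℂ)) •
    (localOp (d := fun _ : Fin 8 => 2) a pauliZ * localOp (d := fun _ : Fin 8 => 2) b pauliZ))

namespace Circuit

/-- The output `ψ(α)` of the circuit on `|+⟩^{⊗8}`; the gate with index `0` acts first. -/
def output (C : Circuit) (α : Fin 7 → ℝ) : Qubits → ℂ :=
  (List.ofFn fun i => zzGate (C.fst i) (C.snd i) (α i)).reverse.prod *ᵥ plus

/-- All outputs of the circuit. -/
def outputs (C : Circuit) : Set (Qubits → ℂ) :=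
  {ψ | ∃ α : Fin 7 → ℝ, (∀ i, 0 ≤ α i ∧ α i < 2 * Real.pi) ∧ ψ = C.output α}

/-- The graph on the parties whose edges are the pairs of wires joined by a gate. -/
def interaction (C : Circuit) : SimpleGraph (Fin 8) where
  Adj x y := ∃ i, (C.fst i = x ∧ C.snd i = y) ∨ (C.fst i = y ∧ C.snd i = x)
  symm := ⟨fun _ _ ⟨i, h⟩ => ⟨i, h.symm⟩⟩
  loopless := ⟨fun _ ⟨i, h⟩ => C.ne i (h.elim (fun h => h.1.trans h.2.symm)
    (fun h => h.1.trans h.2.symm))⟩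

/-- `x` starts an arm of length at least two at `w` in the graph that arises from the interaction
graph when a path with two edges is hung on the last party. -/
def LongArm (C : Circuit) (w x : Fin 8) : Prop :=
  C.interaction.Adj w x ∧ (x = 7 ∨ ∃ y, y ≠ w ∧ C.interaction.Adj x y)

/-- In the interaction graph with a path of two edges hung on the last party, some party has three
arms of length at least two. (At the last party itself the path hung on it is one of them.)
For a tree, this says that the extended tree is not a caterpillar. -/
def Branching (C : Circuit) : Prop :=
  ∃ w, 3 ≤ {x | C.LongArm w x}.ncard + if w = 7 then 1 else 0

end Circuit

/-- Three layers with four, two and one gates: gates join `v₁v₂`, `v₃v₄`, `v₅v₆`, `v₇v₈`, then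
`v₂v₄`, `v₆v₈`, and then `v₄v₈`. -/
def layeredCircuit : Circuit where
  fst := ![0, 2, 4, 6, 1, 5, 3]
  snd := ![1, 3, 5, 7, 3, 7, 7]
  ne := by decide

/-- The inclusion of the eight qubits into the total system; the qubit of each party is spanned by
the first two basis vectors of its system. -/
def embed {d : Fin 8 → ℕ} (ψ : Qubits → ℂ) : Conf d → ℂ :=
  fun x => if h : ∀ k, (x k : ℕ) < 2 then ψ (fun k => ⟨x k, h k⟩) else 0

/-- The target set `S₀` of a circuit, within the total system. -/
def targetSet (C : Circuit) : Set (Conf d₀ → ℂ) := embed '' C.outputs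

/-- Some resource state that consists of bipartite entanglement and fits within the local
dimensions `d` is a common resource state for `S`. -/
def AchievableByBipartite (d : Fin 8 → ℕ) (S : Set (Conf d → ℂ)) : Prop :=
  ∃ φ : Conf d → ℂ, IsState φ ∧ ConsistsOfBipartite φ ∧ IsCommonResource φ S

end BipartiteResource

end

/-!
LOCC does not raise the Schmidt rank across a cut. For infinitely many rounds this holds because
the vectors of bounded Schmidt rank form a closed cone `K`: a unit vector `ψ` outside `K` has
overlap bounded away from `1` with all unit vectors of `K`, hence with all mixtures of them, so
a pure limit of such mixtures lies in `K`.

At the angle `π / 4` a gate is, up to row and column phases, a Hadamard matrix. Switching on only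
the gates of a matching of `G(C)` that crosses a cut thus gives Schmidt rank `2 ^ m` for `m` edges.
A common resource state must provide these ranks within the local dimensions: its graph is
connected, has degrees at most two and degree at most one at `v₈`, so it is a path that starts at
`v₈`, and each of its edges has Schmidt rank less than four. Hence, in the order along this path,
no cut is crossed by two disjoint edges of `G(C)`. This stays true when a path is hung on `v₈` and
its vertices are put in front. But of three long arms at a vertex `w`, two start on the same side
of `w`, and then some cut is crossed by both the edge from `w` to the farther start and the second
edge of the arm at the nearer one.
-/

noncomputable section

namespace BipartiteResource

open Filter Topology Matrix

theorem norm_inner_sq_le_of_forall_le_norm_sub_smul {𝕜 E : Type*} [RCLike 𝕜]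
    [NormedAddCommGroup E] [InnerProductSpace 𝕜 E] {x y : E} {δ : ℝ} (hδ : 0 ≤ δ)
    (h : ∀ t : 𝕜, δ ≤ ‖y - t • x‖) :
    ‖inner 𝕜 y x‖ ^ 2 ≤ (‖y‖ ^ 2 - δ ^ 2) * ‖x‖ ^ 2 := by
  rcases eq_or_ne x 0 with rfl | hx
  · simp
  have hxpos : 0 < ‖x‖ ^ 2 := by positivity
  set t : 𝕜 := (((‖x‖ ^ 2)⁻¹ : ℝ) : 𝕜) * inner 𝕜 x y with ht
  have hre : RCLike.re (inner 𝕜 y (t • x)) = ‖inner 𝕜 y x‖ ^ 2 / ‖x‖ ^ 2 := by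
    rw [inner_smul_right, ht, mul_assoc, RCLike.re_ofReal_mul, inner_mul_symm_re_eq_norm,
      norm_mul, norm_inner_symm x y]
    ring
  have hnorm : ‖t • x‖ ^ 2 = ‖inner 𝕜 y x‖ ^ 2 / ‖x‖ ^ 2 := by
    rw [norm_smul, ht, norm_mul, RCLike.norm_ofReal, abs_of_nonneg (by positivity),
      norm_inner_symm x y]
    field_simp
  have hsub : ‖y - t • x‖ ^ 2 = ‖y‖ ^ 2 - ‖inner 𝕜 y x‖ ^ 2 / ‖x‖ ^ 2 := by
    rw [@norm_sub_sq 𝕜, hre, hnorm]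
    ring
  have hsq : δ ^ 2 ≤ ‖y - t • x‖ ^ 2 := by gcongr; exact h t
  exact (div_le_iff₀ hxpos).1 (by linarith)

section Density

variable {ι : Type*} [Fintype ι]

theorem re_trace_density (χ : ι → ℂ) : (density χ).trace.re = ‖WithLp.toLp 2 χ‖ ^ 2 := by
  rw [density, trace_vecMulVec, ← EuclideanSpace.inner_toLp_toLp, inner_self_eq_norm_sq_to_K]
  norm_cast

theorem re_star_dotProduct_density_mulVec (ψ χ : ι → ℂ) :
    (star ψ ⬝ᵥ density χ *ᵥ ψ).re = ‖star ψ ⬝ᵥ χ‖ ^ 2 := by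
  rw [density, vecMulVec_mulVec, dotProduct_smul, MulOpposite.smul_eq_mul_unop,
    MulOpposite.unop_op, star_dotProduct χ, RCLike.star_def, RCLike.mul_conj]
  norm_cast

theorem mul_density_mul {κ : Type*} (A : Matrix κ ι ℂ) (χ : ι → ℂ) :
    A * density χ * Aᴴ = density (A *ᵥ χ) := by
  rw [density, density, mul_vecMulVec, vecMulVec_mul, star_mulVec]

variable {K : Set (ι → ℂ)} {ψ : ι → ℂ}

theorem re_star_dotProduct_mulVec_le_of_mem_closure {c : ℝ}
    (hc : ∀ χ ∈ K, ‖star ψ ⬝ᵥ χ‖ ^ 2 ≤ c * ‖WithLp.toLp 2 χ‖ ^ 2) {ρ : Matrix ι ι ℂ}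
    (hρ : ρ ∈ AddSubmonoid.closure (density '' K)) :
    (star ψ ⬝ᵥ ρ *ᵥ ψ).re ≤ c * ρ.trace.re := by
  induction hρ using AddSubmonoid.closure_induction with
  | mem ρ hmem =>
    obtain ⟨χ, hχ, rfl⟩ := hmem
    rw [re_star_dotProduct_density_mulVec, re_trace_density]
    exact hc χ hχ
  | zero => simp
  | add a b _ _ ha hb =>
    rw [add_mulVec, dotProduct_add, trace_add, Complex.add_re, Complex.add_re, mul_add]
    exact add_le_add ha hb

theorem exists_lt_forall_norm_star_dotProduct_sq_le (hclosed : IsClosed K)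
    (hsmul : ∀ c : ℂ, ∀ χ ∈ K, c • χ ∈ K) (hψ : ψ ∉ K) :
    ∃ c < ‖WithLp.toLp 2 ψ‖ ^ 2, ∀ χ ∈ K,
      ‖star ψ ⬝ᵥ χ‖ ^ 2 ≤ c * ‖WithLp.toLp 2 χ‖ ^ 2 := by
  have hopen : IsOpen {x : EuclideanSpace ℂ ι | x.ofLp ∈ Kᶜ} :=
    hclosed.isOpen_compl.preimage (PiLp.continuous_ofLp 2 _)
  obtain ⟨δ, hδ, hball⟩ := Metric.isOpen_iff.1 hopen (WithLp.toLp 2 ψ) hψ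
  refine ⟨‖WithLp.toLp 2 ψ‖ ^ 2 - δ ^ 2, by nlinarith, fun χ hχ => ?_⟩
  rw [dotProduct_comm, ← EuclideanSpace.inner_toLp_toLp]
  refine norm_inner_sq_le_of_forall_le_norm_sub_smul (𝕜 := ℂ) hδ.le fun t => ?_
  by_contra! hlt
  refine hball (?_ : t • WithLp.toLp 2 χ ∈ _) (hsmul t χ hχ)
  rwa [mem_ball_iff_norm, norm_sub_rev]

end Density

theorem mem_of_tendsto_density {ι : Type*} [Finite ι] {K : Set (ι → ℂ)} {ψ : ι → ℂ}
    (hclosed : IsClosed K) (hne : K.Nonempty) (hsmul : ∀ c : ℂ, ∀ χ ∈ K, c • χ ∈ K)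
    {α : Type*} {l : Filter α} [l.NeBot] {ρ : α → Matrix ι ι ℂ}
    (hρ : ∀ n, ρ n ∈ AddSubmonoid.closure (density '' K))
    (hlim : Tendsto ρ l (𝓝 (density ψ))) : ψ ∈ K := by
  cases nonempty_fintype ι
  by_contra hψ
  have hψ0 : WithLp.toLp 2 ψ ≠ 0 := fun h => hψ <| by
    obtain ⟨χ, hχ⟩ := hne
    simpa [(WithLp.toLp_eq_zero 2).1 h] using hsmul 0 χ hχ
  obtain ⟨c, hcψ, hc⟩ := exists_lt_forall_norm_star_dotProduct_sq_le hclosed hsmul hψ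
  have hle : (star ψ ⬝ᵥ density ψ *ᵥ ψ).re ≤ c * (density ψ).trace.re := by
    refine le_of_tendsto_of_tendsto' (b := l)
      (f := fun n => (star ψ ⬝ᵥ ρ n *ᵥ ψ).re) (g := fun n => c * (ρ n).trace.re) ?_ ?_
      fun n => re_star_dotProduct_mulVec_le_of_mem_closure hc (hρ n)
    · exact ((by fun_prop : Continuous fun σ : Matrix ι ι ℂ =>
        (star ψ ⬝ᵥ σ *ᵥ ψ).re).tendsto _).comp hlim
    · exact ((by fun_prop : Continuous fun σ : Matrix ι ι ℂ =>
        c * σ.trace.re).tendsto _).comp hlim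
  have hself : ‖star ψ ⬝ᵥ ψ‖ = ‖WithLp.toLp 2 ψ‖ ^ 2 := by
    rw [dotProduct_comm, ← EuclideanSpace.inner_toLp_toLp, inner_self_eq_norm_sq_to_K]
    simp
  rw [re_star_dotProduct_density_mulVec, re_trace_density, hself] at hle
  have hpos : 0 < ‖WithLp.toLp 2 ψ‖ ^ 2 := by positivity
  nlinarith

section LOCC

variable {N : ℕ} {d : Fin N → ℕ} {K : Set (Conf d → ℂ)}

theorem Protocol.run_mem_closure_density
    (hK : ∀ k A, ∀ χ ∈ K, localOp k A *ᵥ χ ∈ K) (P : Protocol d)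
    {ρ : Matrix (Conf d) (Conf d) ℂ} (hρ : ρ ∈ AddSubmonoid.closure (density '' K)) :
    P.run ρ ∈ AddSubmonoid.closure (density '' K) := by
  have conj_mem (k A) {σ} (hσ : σ ∈ AddSubmonoid.closure (density '' K)) :
      localOp k A * σ * (localOp k A)ᴴ ∈ AddSubmonoid.closure (density '' K) := by
    induction hσ using AddSubmonoid.closure_induction with
    | mem σ hmem =>
      obtain ⟨χ, hχ, rfl⟩ := hmem
      rw [mul_density_mul]
      exact AddSubmonoid.subset_closure ⟨_, hK k A χ hχ, rfl⟩
    | zero => simp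
    | add a b _ _ ha hb =>
      rw [mul_add, add_mul]
      exact add_mem ha hb
  induction P generalizing ρ with
  | done => exact hρ
  | step k m s A _ next ih =>
    exact sum_mem fun i _ => ih i (sum_mem fun j _ => conj_mem k _ hρ)

theorem LOCCTransforms.mem_of_isClosed {φ ψ : Conf d → ℂ} (h : LOCCTransforms φ ψ)
    (hclosed : IsClosed K) (hsmul : ∀ c : ℂ, ∀ χ ∈ K, c • χ ∈ K)
    (hK : ∀ k A, ∀ χ ∈ K, localOp k A *ᵥ χ ∈ K) (hφ : φ ∈ K) : ψ ∈ K := by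
  obtain ⟨P, -, hlim⟩ := h
  exact mem_of_tendsto_density hclosed ⟨φ, hφ⟩ hsmul
    (fun n => (P n).run_mem_closure_density hK (AddSubmonoid.subset_closure ⟨φ, hφ, rfl⟩)) hlim

end LOCC

section Rank

variable {m n : Type*} [Fintype n] {K : Type*} [Field K]

theorem exists_eq_mul_of_rank (A : Matrix m n K) :
    ∃ (B : Matrix m (Fin A.rank) K) (C : Matrix (Fin A.rank) n K), A = B * C := by
  let b := Module.finBasisOfFinrankEq K (LinearMap.range A.mulVecLin) (show _ = A.rank from rfl)
  have hcol (j : n) : A.col j ∈ LinearMap.range A.mulVecLin := by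
    rw [range_mulVecLin]
    exact Submodule.subset_span ⟨j, rfl⟩
  refine ⟨of fun i k => (b k : m → K) i, of fun k j => b.repr ⟨A.col j, hcol j⟩ k, ?_⟩
  ext i j
  have hsum := congrArg (LinearMap.range A.mulVecLin).subtype (b.sum_repr ⟨A.col j, hcol j⟩)
  rw [map_sum] at hsum
  simpa [mul_apply, mul_comm] using (congrFun hsum i).symm

theorem rank_hadamard_le (A B : Matrix m n K) : (A ⊙ B).rank ≤ A.rank * B.rank := by
  obtain ⟨A₁, A₂, hA⟩ := exists_eq_mul_of_rank A
  obtain ⟨B₁, B₂, hB⟩ := exists_eq_mul_of_rank B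
  let P : Matrix m (Fin A.rank × Fin B.rank) K := of fun i k => A₁ i k.1 * B₁ i k.2
  let Q : Matrix (Fin A.rank × Fin B.rank) n K := of fun k j => A₂ k.1 j * B₂ k.2 j
  have hmul : A ⊙ B = P * Q := by
    ext i j
    have hAij : A i j = ∑ k, A₁ i k * A₂ k j := congrFun₂ hA i j
    have hBij : B i j = ∑ l, B₁ i l * B₂ l j := congrFun₂ hB i j
    rw [hadamard_apply, hAij, hBij, mul_apply, Finset.sum_mul_sum, Fintype.sum_prod_type]
    exact Finset.sum_congr rfl fun k _ => Finset.sum_congr rfl fun l _ =>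
      mul_mul_mul_comm _ _ _ _
  rw [hmul]
  exact (rank_mul_le_right _ _).trans ((rank_le_card_height _).trans (by simp))

theorem isClosed_setOf_rank_le [Finite m] {𝕜 : Type*} [RCLike 𝕜] (r : ℕ) :
    IsClosed {A : Matrix m n 𝕜 | A.rank ≤ r} := by
  classical
  cases nonempty_fintype m
  let Λ : Matrix m n 𝕜 →ₗ[𝕜] (n → 𝕜) →L[𝕜] (m → 𝕜) :=
    (LinearMap.toContinuousLinearMap.toLinearMap).comp (toLin' (R := 𝕜)).toLinearMap
  have hopen := (isOpen_setOfPred_nat_le_rank (𝕜 := 𝕜) (E := n → 𝕜) (F := m → 𝕜) (r + 1)).preimage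
    Λ.continuous_of_finiteDimensional
  rw [← isOpen_compl_iff]
  convert hopen using 1
  ext A
  have hrank : (Λ A).toLinearMap.rank = A.rank := by
    rw [Matrix.rank, Module.finrank_eq_rank]
    rfl
  rw [Set.mem_compl_iff, Set.mem_ofPred_eq, not_le, Set.mem_preimage, Set.mem_ofPred_eq, hrank,
    Nat.cast_le, Nat.succ_le_iff]

end Rank

section PiKronecker

variable {ι : Type*} [Fintype ι] {R : Type*} {α β γ : ι → Type*}

/-- The Kronecker product of a family of matrices: the tensor product of the operators `W i`, in
the product bases. -/
def piKronecker [CommMonoid R] (W : (i : ι) → Matrix (γ i) (β i) R) :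
    Matrix ((i : ι) → γ i) ((i : ι) → β i) R :=
  of fun x y => ∏ i, W i (x i) (y i)

theorem piKronecker_mul [DecidableEq ι] [CommSemiring R] [∀ i, Fintype (β i)]
    (V : (i : ι) → Matrix (γ i) (β i) R) (W : (i : ι) → Matrix (β i) (α i) R) :
    piKronecker V * piKronecker W = piKronecker fun i => V i * W i := by
  ext x z
  simp only [piKronecker, mul_apply, of_apply, ← Finset.prod_mul_distrib]
  rw [Finset.prod_univ_sum, Fintype.piFinset_univ]

theorem piKronecker_one [CommSemiring R] [∀ i, DecidableEq (β i)] [DecidableEq ((i : ι) → β i)] :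
    piKronecker (fun i => (1 : Matrix (β i) (β i) R)) = 1 := by
  ext x y
  simp [piKronecker, one_apply, Fintype.prod_boole, funext_iff]

end PiKronecker

section CutRank

variable {ι : Type*} {β γ : ι → Type*} {K : Type*} (p : ι → Prop) [DecidablePred p]

/-- The amplitudes `χ` as a matrix whose rows are labelled by the parties satisfying `p` and whose
columns are labelled by the other ones. -/
def cutMatrix (χ : ((i : ι) → β i) → K) :
    Matrix ((i : {i // p i}) → β i) ((i : {i // ¬ p i}) → β i) K :=
  of fun u v => χ ((Equiv.piEquivPiSubtypeProd p β).symm (u, v))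

theorem cutMatrix_piKronecker_mulVec [Fintype ι] [DecidableEq ι] [∀ i, Fintype (β i)]
    [CommSemiring K] (W : (i : ι) → Matrix (γ i) (β i) K) (χ : ((i : ι) → β i) → K) :
    cutMatrix p (piKronecker W *ᵥ χ) =
      piKronecker (fun i : {i // p i} => W i) * cutMatrix p χ *
        (piKronecker fun i : {i // ¬ p i} => W i)ᵀ := by
  ext x x'
  simp only [cutMatrix, piKronecker, mulVec, dotProduct, mul_apply, of_apply, transpose_apply,
    Finset.sum_mul]
  rw [← (Equiv.piEquivPiSubtypeProd p β).symm.sum_comp, Fintype.sum_prod_type, Finset.sum_comm]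
  refine Finset.sum_congr rfl fun v _ => Finset.sum_congr rfl fun u _ => ?_
  have hp (i : {i // p i}) : W i ((Equiv.piEquivPiSubtypeProd p γ).symm (x, x') i)
      ((Equiv.piEquivPiSubtypeProd p β).symm (u, v) i) = W i (x i) (u i) := by
    simp [i.2]
  have hnp (i : {i // ¬ p i}) : W i ((Equiv.piEquivPiSubtypeProd p γ).symm (x, x') i)
      ((Equiv.piEquivPiSubtypeProd p β).symm (u, v) i) = W i (x' i) (v i) := by
    simp [i.2]
  rw [← Fintype.prod_subtype_mul_prod_subtype p]
  simp only [hp, hnp]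
  ring

variable [Fintype ι] [DecidableEq ι] [∀ i, Fintype (β i)] [Field K]

/-- The Schmidt rank of `χ` across the cut that separates the parties satisfying `p` from the
other ones. -/
def cutRank (χ : ((i : ι) → β i) → K) : ℕ :=
  (cutMatrix p χ).rank

theorem cutRank_piKronecker_mulVec_le [∀ i, Fintype (γ i)]
    (W : (i : ι) → Matrix (γ i) (β i) K) (χ : ((i : ι) → β i) → K) :
    cutRank p (piKronecker W *ᵥ χ) ≤ cutRank p χ := by
  rw [cutRank, cutMatrix_piKronecker_mulVec]
  exact (rank_mul_le_left _ _).trans (rank_mul_le_right _ _)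

theorem cutRank_smul_le (c : K) (χ : ((i : ι) → β i) → K) :
    cutRank p (c • χ) ≤ cutRank p χ := by
  rw [cutRank, show cutMatrix p (c • χ) = c • cutMatrix p χ from rfl]
  rcases eq_or_ne c 0 with rfl | hc
  · simp
  · exact (rank_smul_of_mem_nonZeroDivisors _ (mem_nonZeroDivisors_of_ne_zero hc)).le

theorem isClosed_setOf_cutRank_le {𝕜 : Type*} [RCLike 𝕜] (r : ℕ) :
    IsClosed {χ : ((i : ι) → β i) → 𝕜 | cutRank p χ ≤ r} :=
  (isClosed_setOf_rank_le r).preimage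
    (continuous_matrix fun _ _ => continuous_apply _ : Continuous (cutMatrix p))

theorem cutRank_comp_map_le [∀ i, Fintype (γ i)] (f : (i : ι) → γ i → β i)
    (χ : ((i : ι) → β i) → K) :
    cutRank p (fun y : (i : ι) → γ i => χ fun i => f i (y i)) ≤ cutRank p χ := by
  have hsub : cutMatrix p (fun y : (i : ι) → γ i => χ fun i => f i (y i)) =
      (cutMatrix p χ).submatrix (fun u i => f i (u i)) (fun v i => f i (v i)) := by
    ext u v
    refine congrArg χ (funext fun i => ?_)
    by_cases hi : p i <;> simp [hi]
  rw [cutRank, hsub]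
  exact rank_submatrix_le _ _ _

theorem cutRank_mul_le (χ ξ : ((i : ι) → β i) → K) :
    cutRank p (χ * ξ) ≤ cutRank p χ * cutRank p ξ :=
  rank_hadamard_le (cutMatrix p χ) (cutMatrix p ξ)

theorem cutRank_comp_restrict_pos_le_one (f : ((i : {i // p i}) → β i) → K) :
    cutRank p (fun y => f (Subtype.restrict p y)) ≤ 1 := by
  have hvec : cutMatrix p (fun y => f (Subtype.restrict p y)) = vecMulVec f 1 := by
    ext u v
    simp only [cutMatrix, of_apply, vecMulVec_apply, Pi.one_apply, mul_one]
    exact congrArg (fun w => f w.1) ((Equiv.piEquivPiSubtypeProd p β).apply_symm_apply (u, v))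
  rw [cutRank, hvec]
  exact rank_vecMulVec_le _ _

theorem cutRank_comp_restrict_neg_le_one (g : ((i : {i // ¬ p i}) → β i) → K) :
    cutRank p (fun y => g (Subtype.restrict (fun i => ¬ p i) y)) ≤ 1 := by
  have hvec : cutMatrix p (fun y => g (Subtype.restrict (fun i => ¬ p i) y)) =
      vecMulVec 1 g := by
    ext u v
    simp only [cutMatrix, of_apply, vecMulVec_apply, Pi.one_apply, one_mul]
    exact congrArg (fun w => g w.2) ((Equiv.piEquivPiSubtypeProd p β).apply_symm_apply (u, v))
  rw [cutRank, hvec]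
  exact rank_vecMulVec_le _ _

theorem cutRank_prod_le {κ : Type*} (s : Finset κ) (f : κ → ((i : ι) → β i) → K) :
    cutRank p (∏ e ∈ s, f e) ≤ ∏ e ∈ s, cutRank p (f e) := by
  classical
  induction s using Finset.induction_on with
  | empty => exact cutRank_comp_restrict_pos_le_one p (fun _ => 1)
  | insert e s he ih =>
    rw [Finset.prod_insert he, Finset.prod_insert he]
    exact (cutRank_mul_le p _ _).trans (Nat.mul_le_mul_left _ ih)

theorem cutRank_apply_apply_le {a b : ι} (ha : p a) (hb : ¬ p b) {m n : Type*} [Fintype n]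
    (F : Matrix m n K) (f : β a → m) (g : β b → n) :
    cutRank p (fun y => F (f (y a)) (g (y b))) ≤ F.rank := by
  have hsub : cutMatrix p (fun y => F (f (y a)) (g (y b))) =
      F.submatrix (fun u => f (u ⟨a, ha⟩)) (fun v => g (v ⟨b, hb⟩)) := by
    ext u v
    simp [cutMatrix, ha, hb]
  rw [cutRank, hsub]
  exact rank_submatrix_le _ _ _

end CutRank

section LOCC

variable {N : ℕ} {d : Fin N → ℕ}

theorem localOp_eq_piKronecker (k : Fin N) (A : Matrix (Fin (d k)) (Fin (d k)) ℂ) :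
    localOp k A = piKronecker (Function.update
      (fun j => (1 : Matrix (Fin (d j)) (Fin (d j)) ℂ)) k A) := by
  ext x y
  have hprod : ∏ j ∈ Finset.univ.erase k, Function.update
      (fun j => (1 : Matrix (Fin (d j)) (Fin (d j)) ℂ)) k A j (x j) (y j) =
      if ∀ j, j ≠ k → x j = y j then 1 else 0 := by
    rw [Finset.prod_congr rfl fun j hj => by
      rw [Function.update_of_ne (Finset.ne_of_mem_erase hj), one_apply], Finset.prod_ite_zero]
    simp
  rw [piKronecker, of_apply, ← Finset.mul_prod_erase _ _ (Finset.mem_univ k),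
    Function.update_self, hprod, localOp, mul_ite, mul_one, mul_zero]

theorem LOCCTransforms.cutRank_le {φ ψ : Conf d → ℂ} (h : LOCCTransforms φ ψ)
    (p : Fin N → Prop) [DecidablePred p] : cutRank p ψ ≤ cutRank p φ := by
  refine h.mem_of_isClosed (isClosed_setOf_cutRank_le p (cutRank p φ))
    (fun c χ hχ => (cutRank_smul_le p c χ).trans hχ) (fun k A χ hχ => ?_) (Set.mem_ofPred.2 le_rfl)
  rw [localOp_eq_piKronecker]
  exact (cutRank_piKronecker_mulVec_le p _ χ).trans hχ

end LOCC

namespace Distribution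

variable {N : ℕ} (D : Distribution N)

theorem two_le_dim {k l : Fin N} (h : D.graph.Adj k l) : 2 ≤ D.dim k l := by
  by_contra! hlt
  have : Subsingleton (Fin (D.dim k l)) := Fin.subsingleton_iff_le_one.2 (by omega)
  rcases lt_or_gt_of_ne h.ne with hkl | hlk
  · refine D.entangled k l hkl h ?_
    rcases isEmpty_or_nonempty (Fin (D.dim k l)) with _ | ⟨⟨a₀⟩⟩
    · exact ⟨fun _ => 0, fun _ => 0, isEmptyElim⟩
    · exact ⟨fun _ => 1, D.state k l a₀, fun a b => by rw [one_mul, Subsingleton.elim a a₀]⟩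
  · refine D.entangled l k hlk h.symm ?_
    rcases isEmpty_or_nonempty (Fin (D.dim k l)) with _ | ⟨⟨b₀⟩⟩
    · exact ⟨fun _ => 0, fun _ => 0, fun _ => isEmptyElim⟩
    · exact ⟨fun a => D.state l k a b₀, fun _ => 1, fun a b => by
        rw [mul_one, Subsingleton.elim b b₀]⟩

section Local

open Classical in
theorem card_local_le {d : ℕ} {k : Fin N} {W : Matrix (Fin d) (D.Local k) ℂ}
    (hW : Wᴴ * W = 1) : Fintype.card (D.Local k) ≤ d :=
  calc Fintype.card (D.Local k) = (Wᴴ * W).rank := by rw [hW, rank_one]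
    _ ≤ W.rank := rank_mul_le_right _ _
    _ ≤ d := (rank_le_card_height W).trans_eq (Fintype.card_fin d)

open Classical in
theorem card_local (k : Fin N) :
    Fintype.card (D.Local k) = ∏ l with D.graph.Adj k l, D.dim k l := by
  simp only [Fintype.card_pi, Fintype.card_fin]
  exact (Finset.prod_subtype _ (by simp) (D.dim k)).symm

open Classical in
theorem prod_dim_le_card_local {k : Fin N} (s : Finset (Fin N))
    (hs : ∀ l ∈ s, D.graph.Adj k l) : ∏ l ∈ s, D.dim k l ≤ Fintype.card (D.Local k) := by
  rw [card_local]
  exact Finset.prod_le_prod_of_subset_of_one_le' (fun l hl => by simpa using hs l hl)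
    fun l hl _ => one_le_two.trans (D.two_le_dim (by simpa using hl))

end Local

section CutRank

variable (p : Fin N → Prop) [DecidablePred p]

/-- The factor of the edge `e` in `D.amplitude`. -/
def edgeFactor (e : D.Edge) (y : (k : Fin N) → D.Local k) : ℂ :=
  D.state e.1.1 e.1.2 (y e.1.1 ⟨e.1.2, e.2.2⟩) (y e.1.2 ⟨e.1.1, e.2.2.symm⟩)

open Classical in
theorem cutRank_edgeFactor_le_one {e : D.Edge} (he : p e.1.1 ↔ p e.1.2) :
    cutRank p (D.edgeFactor e) ≤ 1 := by
  by_cases h : p e.1.1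
  · exact cutRank_comp_restrict_pos_le_one (β := D.Local) p fun u => D.state e.1.1 e.1.2
      (u ⟨e.1.1, h⟩ ⟨e.1.2, e.2.2⟩) (u ⟨e.1.2, he.1 h⟩ ⟨e.1.1, e.2.2.symm⟩)
  · exact cutRank_comp_restrict_neg_le_one (β := D.Local) p fun v => D.state e.1.1 e.1.2
      (v ⟨e.1.1, h⟩ ⟨e.1.2, e.2.2⟩) (v ⟨e.1.2, mt he.2 h⟩ ⟨e.1.1, e.2.2.symm⟩)

open Classical in
theorem cutRank_edgeFactor_le_min {e : D.Edge} (he : ¬(p e.1.1 ↔ p e.1.2)) :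
    cutRank p (D.edgeFactor e) ≤ min (D.dim e.1.1 e.1.2) (D.dim e.1.2 e.1.1) := by
  let F : Matrix (Fin (D.dim e.1.1 e.1.2)) (Fin (D.dim e.1.2 e.1.1)) ℂ :=
    of (D.state e.1.1 e.1.2)
  have hF : F.rank ≤ min (D.dim e.1.1 e.1.2) (D.dim e.1.2 e.1.1) :=
    le_min (rank_le_height F) (rank_le_width F)
  by_cases h : p e.1.1
  · have h' : ¬ p e.1.2 := fun h' => he (iff_of_true h h')
    exact (cutRank_apply_apply_le (β := D.Local) p h h' F (fun u => u ⟨e.1.2, e.2.2⟩)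
      fun v => v ⟨e.1.1, e.2.2.symm⟩).trans hF
  · have h' : p e.1.2 := by tauto
    exact (cutRank_apply_apply_le (β := D.Local) p h' h Fᵀ (fun u => u ⟨e.1.1, e.2.2.symm⟩)
      fun v => v ⟨e.1.2, e.2.2⟩).trans ((rank_transpose F).trans_le hF)

open Classical in
/-- The Schmidt rank across the cut `p` of maximally entangled states along the edges of `D`: the
product of the local dimensions of the crossing edges. -/
def cutDim : ℕ :=
  ∏ e : D.Edge with ¬(p e.1.1 ↔ p e.1.2), min (D.dim e.1.1 e.1.2) (D.dim e.1.2 e.1.1)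

open Classical in
theorem cutRank_amplitude_le_cutDim : cutRank p D.amplitude ≤ D.cutDim p := by
  have hprod : D.amplitude = ∏ e, D.edgeFactor e := by
    ext y
    rw [Finset.prod_apply]
    rfl
  rw [hprod, cutDim, Finset.prod_filter]
  refine (cutRank_prod_le p _ _).trans (Finset.prod_le_prod' fun e _ => ?_)
  split_ifs with he
  · exact D.cutRank_edgeFactor_le_one p he
  · exact D.cutRank_edgeFactor_le_min p he

end CutRank

end Distribution

section Cut

variable {V : Type*}

/-- The edges `{a i, b i}` form a matching of `G` all of whose edges cross the cut between the
vertices satisfying `p`, which contain the `a i`, and the other ones. -/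
structure IsCutMatching (G : SimpleGraph V) (p : V → Prop) {m : ℕ} (a b : Fin m → V) : Prop where
  adj : ∀ i, G.Adj (a i) (b i)
  left : ∀ i, p (a i)
  right : ∀ i, ¬ p (b i)
  injective_left : Function.Injective a
  injective_right : Function.Injective b

theorem IsCutMatching.single {G : SimpleGraph V} {p : V → Prop} {a b : V} (hab : G.Adj a b)
    (ha : p a) (hb : ¬ p b) : IsCutMatching G p ![a] ![b] where
  adj := by simpa using hab
  left := by simpa using ha
  right := by simpa using hb
  injective_left := Function.injective_of_subsingleton _
  injective_right := Function.injective_of_subsingleton _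

theorem IsCutMatching.pair {G : SimpleGraph V} {p : V → Prop} {a b c e : V} (hab : G.Adj a b)
    (hce : G.Adj c e) (ha : p a) (hc : p c) (hb : ¬ p b) (he : ¬ p e) (hac : a ≠ c)
    (hbe : b ≠ e) : IsCutMatching G p ![a, c] ![b, e] where
  adj := by simpa using ⟨hab, hce⟩
  left := by simpa using ⟨ha, hc⟩
  right := by simpa using ⟨hb, he⟩
  injective_left := by simpa [Function.Injective, eq_comm] using hac
  injective_right := by simpa [Function.Injective, eq_comm] using hbe

/-- For each matching of `G` across a cut, some state of `S` has at least the Schmidt rank across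
this cut of a tensor product of entangled qubit pairs, one for each edge of the matching. -/
def EntanglesMatchings {N : ℕ} {d : Fin N → ℕ} (G : SimpleGraph (Fin N))
    (S : Set (Conf d → ℂ)) : Prop :=
  ∀ (p : Fin N → Prop) [DecidablePred p] {m : ℕ} (a b : Fin m → Fin N),
    IsCutMatching G p a b → ∃ ψ ∈ S, 2 ^ m ≤ cutRank p ψ

end Cut

section Rank

variable {ι : Type*} [Fintype ι] [DecidableEq ι] {K : Type*} [Field K] {β : ι → Type*}
  [∀ i, Fintype (β i)]

theorem isUnit_piKronecker [∀ i, DecidableEq (β i)] {W : (i : ι) → Matrix (β i) (β i) K}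
    (hW : ∀ i, IsUnit (W i)) : IsUnit (piKronecker W) := by
  refine IsUnit.of_mul_eq_one (piKronecker fun i => (W i)⁻¹) ?_
  simp only [piKronecker_mul, fun i => mul_nonsing_inv _ ((isUnit_iff_isUnit_det _).1 (hW i)),
    piKronecker_one]

theorem rank_of_ite_le_cutRank (p : ι → Prop) [DecidablePred p] {m n : Type*}
    [Fintype n] (χ : ((i : ι) → β i) → K) (q : m → (i : ι) → β i) (q' : n → (i : ι) → β i) :
    (of fun i j => χ fun k => if p k then q i k else q' j k : Matrix m n K).rank ≤
      cutRank p χ :=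
  rank_submatrix_le (cutMatrix p χ) (fun i k => q i k) (fun j k => q' j k)

end Rank

section Gates

theorem localOp_diagonal {N : ℕ} {d : Fin N → ℕ} (k : Fin N) (v : Fin (d k) → ℂ) :
    localOp k (diagonal v) = diagonal fun x => v (x k) := by
  ext x y
  rw [localOp, diagonal_apply, diagonal_apply]
  by_cases hxy : x = y
  · simp [hxy]
  · rw [if_neg hxy]
    split_ifs with hne hk
    · refine absurd (funext fun j => ?_) hxy
      by_cases hj : j = k
      · exact hj ▸ hk
      · exact hne j hj
    · rfl
    · rfl

/-- The eigenvalues of `pauliZ`. -/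
def sgn : Fin 2 → ℂ := ![1, -1]

theorem pauliZ_eq_diagonal : pauliZ = diagonal sgn := by
  ext i j
  fin_cases i <;> fin_cases j <;> simp [pauliZ, sgn]

/-- The gate `exp(i t Z ⊗ Z)` is diagonal; these are its eigenvalues, as a matrix from one qubit
to the other. -/
def zzPhase (t : ℝ) : Matrix (Fin 2) (Fin 2) ℂ :=
  of fun r s => Complex.exp (Complex.I * t * (sgn r * sgn s))

theorem zzPhase_comm (t : ℝ) (r s : Fin 2) : zzPhase t r s = zzPhase t s r := by
  simp only [zzPhase, of_apply, mul_comm]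

theorem zzPhase_zero (r s : Fin 2) : zzPhase 0 r s = 1 := by
  simp [zzPhase]

theorem isUnit_zzPhase_pi_div_four : IsUnit (zzPhase (Real.pi / 4)) := by
  have hI : Complex.exp (Complex.I * (Real.pi / 4 : ℝ)) ^ 2 = Complex.I := by
    rw [← Complex.exp_nat_mul]
    refine Eq.trans (congrArg Complex.exp ?_) Complex.exp_pi_div_two_mul_I
    push_cast
    ring
  have hdet : (zzPhase (Real.pi / 4)).det = 2 * Complex.I := by
    simp only [det_fin_two, zzPhase, sgn, of_apply, cons_val_zero, cons_val_one, mul_one,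
      mul_neg, neg_neg, Complex.exp_neg]
    rw [← pow_two, ← pow_two, inv_pow, hI, Complex.inv_I]
    ring
  rw [isUnit_iff_isUnit_det, hdet]
  simp

theorem zzGate_eq_diagonal (a b : Fin 8) (t : ℝ) :
    zzGate a b t = diagonal fun x => zzPhase t (x a) (x b) := by
  rw [zzGate, pauliZ_eq_diagonal, localOp_diagonal, localOp_diagonal, diagonal_mul_diagonal,
    ← diagonal_smul, exp_diagonal]
  congr 1
  ext x
  rw [Pi.coe_exp, ← Complex.exp_eq_exp_ℂ]
  rfl

theorem Circuit.output_apply (C : Circuit) (α : Fin 7 → ℝ) (x : Qubits) :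
    C.output α x = (∏ i, zzPhase (α i) (x (C.fst i)) (x (C.snd i))) * plus x := by
  have hgates : (List.ofFn fun i => zzGate (C.fst i) (C.snd i) (α i)) =
      (List.ofFn fun i => fun x : Qubits => zzPhase (α i) (x (C.fst i)) (x (C.snd i))).map
        (diagonalRingHom Qubits ℂ) := by
    rw [List.map_ofFn]
    congr 1
    ext1 i
    exact zzGate_eq_diagonal _ _ _
  rw [Circuit.output, hgates, ← List.map_reverse, ← map_list_prod, List.prod_reverse,
    List.prod_ofFn, diagonalRingHom_apply, mulVec_diagonal, Finset.prod_apply]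

end Gates

section Matchings

theorem Circuit.exists_output_of_isCutMatching (C : Circuit) {p : Fin 8 → Prop} {m : ℕ}
    {a b : Fin m → Fin 8} (h : IsCutMatching C.interaction p a b) :
    ∃ ψ ∈ C.outputs, ∀ x, ψ x = (∏ i, zzPhase (Real.pi / 4) (x (a i)) (x (b i))) * plus x := by
  choose g hg using h.adj
  have hginj : Function.Injective g := by
    intro i j hij
    have hi := hg i
    rw [hij] at hi
    rcases hi with ⟨hi, -⟩ | ⟨hi, hi'⟩ <;> rcases hg j with ⟨hj, -⟩ | ⟨hj, hj'⟩
    · exact h.injective_left (hi.symm.trans hj)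
    · exact absurd (hi.symm.trans hj ▸ h.left i) (h.right j)
    · exact absurd (hi.symm.trans hj ▸ h.left j) (h.right i)
    · exact h.injective_left (hi'.symm.trans hj')
  set α : Fin 7 → ℝ := Function.extend g (fun _ => Real.pi / 4) 0 with hα
  refine ⟨C.output α, ⟨α, fun k => ?_, rfl⟩, fun x => ?_⟩
  · by_cases hk : ∃ i, g i = k
    · obtain ⟨i, rfl⟩ := hk
      rw [hα, hginj.extend_apply]
      constructor <;> linarith [Real.pi_pos]
    · rw [hα, Function.extend_apply' _ _ _ hk]
      exact ⟨le_rfl, Real.two_pi_pos⟩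
  · rw [C.output_apply]
    congr 1
    refine (Fintype.prod_of_injective g hginj _ _ (fun k hk => ?_) fun i => ?_).symm
    · rw [hα, Function.extend_apply' _ _ _ hk, Pi.zero_apply, zzPhase_zero]
    · rw [hα, hginj.extend_apply]
      rcases hg i with ⟨hi, hi'⟩ | ⟨hi, hi'⟩
      · rw [hi, hi']
      · rw [hi, hi', zzPhase_comm]

theorem Circuit.entanglesMatchings_outputs (C : Circuit) :
    EntanglesMatchings C.interaction C.outputs := by
  intro p _ m a b h
  obtain ⟨ψ, hψ, happly⟩ := C.exists_output_of_isCutMatching h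
  refine ⟨ψ, hψ, ?_⟩
  let M : Matrix (Fin m → Fin 2) (Fin m → Fin 2) ℂ :=
    piKronecker fun _ => zzPhase (Real.pi / 4)
  have hsub : (of fun s t => ψ fun k => if p k then Function.extend a s 0 k
      else Function.extend b t 0 k : Matrix (Fin m → Fin 2) (Fin m → Fin 2) ℂ) = plus 0 • M := by
    ext s t
    rw [of_apply, happly, Matrix.smul_apply, smul_eq_mul, mul_comm]
    refine congrArg (plus 0 * ·) (Finset.prod_congr rfl fun i _ => ?_)
    rw [if_pos (h.left i), if_neg (h.right i), h.injective_left.extend_apply,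
      h.injective_right.extend_apply]
  have hplus : plus 0 ≠ 0 := by simp [plus]
  calc 2 ^ m = M.rank := by
        rw [rank_of_isUnit M (isUnit_piKronecker fun _ => isUnit_zzPhase_pi_div_four)]
        simp
    _ = (plus 0 • M).rank :=
        (rank_smul_of_mem_nonZeroDivisors M (mem_nonZeroDivisors_of_ne_zero hplus)).symm
    _ ≤ cutRank p ψ := hsub ▸ rank_of_ite_le_cutRank p ψ _ _

theorem embed_castLE {d : Fin 8 → ℕ} (hd : ∀ k, 2 ≤ d k) (ψ : Qubits → ℂ) (x : Qubits) :
    embed (d := d) ψ (fun k => Fin.castLE (hd k) (x k)) = ψ x :=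
  dif_pos fun k => (x k).2

theorem EntanglesMatchings.image_embed {d : Fin 8 → ℕ} (hd : ∀ k, 2 ≤ d k)
    {G : SimpleGraph (Fin 8)} {S : Set (Qubits → ℂ)} (h : EntanglesMatchings G S) :
    EntanglesMatchings G (embed (d := d) '' S) := by
  intro p _ m a b hab
  obtain ⟨ψ, hψ, hrank⟩ := h p a b hab
  refine ⟨_, Set.mem_image_of_mem _ hψ, hrank.trans ?_⟩
  have hle := cutRank_comp_map_le p (fun k => Fin.castLE (hd k)) (embed ψ)
  simpa only [embed_castLE hd ψ] using hle

end Matchings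

section Layout

variable {V : Type*} {G : SimpleGraph V} {α : Type*}

/-- A linear layout of `G` none of whose cuts is crossed by two disjoint edges. -/
structure IsThinLayout [LT α] (G : SimpleGraph V) (pos : V → α) : Prop where
  injective : Function.Injective pos
  eq_or_eq : ∀ ⦃a b c e : V⦄, G.Adj a b → G.Adj c e → pos a < pos b → pos a < pos e →
    pos c < pos b → pos c < pos e → a = c ∨ b = e

theorem IsThinLayout.toDual [LT α] {pos : V → α} (h : IsThinLayout G pos) :
    IsThinLayout G (OrderDual.toDual ∘ pos) where
  injective := OrderDual.toDual.injective.comp h.injective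
  eq_or_eq _ _ _ _ hab hce h₁ h₂ h₃ h₄ := (h.eq_or_eq hab.symm hce.symm h₁ h₃ h₂ h₄).symm

/-- The neighbours of `w` at which an arm of length at least two starts. -/
def longArms (G : SimpleGraph V) (w : V) : Set V := {x | G.Adj w x ∧ ∃ y, y ≠ w ∧ G.Adj x y}

section Spider

variable [LinearOrder α] {pos : V → α} {w x x' : V}

theorem IsThinLayout.lt_of_mem_longArms (h : IsThinLayout G pos) (hG : G.CliqueFree 3)
    (hx : G.Adj w x) (hx' : x' ∈ longArms G w) (hlt : pos x < pos x') : pos w < pos x' := by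
  obtain ⟨hwx', y, hyw, hxy⟩ := hx'
  by_contra! hle
  have hlt' : pos x' < pos w := hle.lt_of_ne (h.injective.ne hwx'.ne')
  rcases lt_or_gt_of_ne (h.injective.ne hxy.ne) with hy | hy
  · rcases h.eq_or_eq hx.symm hxy (hlt.trans hlt') (hlt.trans hy) hlt' hy with hxx' | hwy
    · exact hlt.ne (congrArg pos hxx')
    · exact hyw hwy.symm
  · rcases h.eq_or_eq hx.symm hxy.symm (hlt.trans hlt') hlt (hy.trans hlt') hy with rfl | rfl
    · classical exact hG _ (SimpleGraph.is3Clique_triple_iff.2 ⟨hx, hwx', hxy.symm⟩)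
    · exact hlt'.ne rfl

theorem IsThinLayout.gt_of_mem_longArms (h : IsThinLayout G pos) (hG : G.CliqueFree 3)
    (hx : G.Adj w x) (hx' : x' ∈ longArms G w) (hlt : pos x' < pos x) : pos x' < pos w :=
  h.toDual.lt_of_mem_longArms hG hx hx' hlt

theorem IsThinLayout.ncard_longArms_le_two (h : IsThinLayout G pos) (hG : G.CliqueFree 3)
    (w : V) : (longArms G w).ncard ≤ 2 := by
  have hinj : Set.InjOn (fun x => pos x < pos w) (longArms G w) := by
    intro x hx y hy hxy
    have hiff : pos x < pos w ↔ pos y < pos w := Eq.to_iff hxy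
    by_contra hne
    rcases lt_or_gt_of_ne (h.injective.ne hne) with hlt | hlt
    · exact (h.lt_of_mem_longArms hG hx.1 hy hlt).not_gt
        (hiff.1 (h.gt_of_mem_longArms hG hy.1 hx hlt))
    · exact (h.lt_of_mem_longArms hG hy.1 hx hlt).not_gt
        (hiff.2 (h.gt_of_mem_longArms hG hx.1 hy hlt))
  calc (longArms G w).ncard
      ≤ (Set.univ : Set Prop).ncard := Set.ncard_le_ncard_of_injOn _ (by simp) hinj
    _ = 2 := by rw [Set.ncard_univ, Nat.card_eq_fintype_card, Fintype.card_prop]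

end Spider

/-- The graph `G` with a new vertex `none` hung on `v`. -/
def pendant (G : SimpleGraph V) (v : V) : SimpleGraph (Option V) :=
  G.map Function.Embedding.some ⊔ SimpleGraph.edge none (some v)

@[simp]
theorem pendant_adj_some_some {v a b : V} : (pendant G v).Adj (some a) (some b) ↔ G.Adj a b := by
  rw [pendant, SimpleGraph.sup_adj, SimpleGraph.map_adj, SimpleGraph.edge_adj]
  simp

@[simp]
theorem pendant_adj_none_left {v : V} {b : Option V} :
    (pendant G v).Adj none b ↔ b = some v := by
  rw [pendant, SimpleGraph.sup_adj, SimpleGraph.map_adj, SimpleGraph.edge_adj]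
  cases b <;> simp

@[simp]
theorem pendant_adj_none_right {v : V} {a : Option V} :
    (pendant G v).Adj a none ↔ a = some v := by
  rw [SimpleGraph.adj_comm, pendant_adj_none_left]

theorem cliqueFree_three_pendant (hG : G.CliqueFree 3) (v : V) :
    (pendant G v).CliqueFree 3 := by
  classical
  intro s hs
  obtain ⟨a, b, c, hab, hac, hbc, -⟩ := SimpleGraph.is3Clique_iff.1 hs
  have ne_none : ∀ {x y z}, (pendant G v).Adj x y → (pendant G v).Adj x z →
      (pendant G v).Adj y z → x ≠ none := by
    rintro x y z hxy hxz hyz rfl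
    rw [pendant_adj_none_left] at hxy hxz
    exact hyz.ne (hxy.trans hxz.symm)
  obtain ⟨a, rfl⟩ := Option.ne_none_iff_exists'.1 (ne_none hab hac hbc)
  obtain ⟨b, rfl⟩ := Option.ne_none_iff_exists'.1 (ne_none hab.symm hbc hac)
  obtain ⟨c, rfl⟩ := Option.ne_none_iff_exists'.1 (ne_none hac.symm hbc.symm hab)
  rw [pendant_adj_some_some] at hab hac hbc
  exact hG _ (SimpleGraph.is3Clique_triple_iff.2 ⟨hab, hac, hbc⟩)

theorem IsThinLayout.pendant [LinearOrder α] {pos : V → α} (h : IsThinLayout G pos) {v : V}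
    (hv : ∀ u, pos v ≤ pos u) :
    IsThinLayout (pendant G v) (fun o => o.elim ⊥ fun u => (pos u : WithBot α)) where
  injective := by
    rintro (_ | a) (_ | b) hab
    · rfl
    · simp at hab
    · simp at hab
    · simpa [h.injective.eq_iff] using hab
  eq_or_eq := by
    rintro (_ | a) b (_ | c) e hab hce hlt₁ hlt₂ hlt₃ hlt₄
    · exact .inl rfl
    · rw [pendant_adj_none_left] at hab
      subst hab
      exact absurd (WithBot.coe_lt_coe.1 hlt₃) (hv c).not_gt
    · rw [pendant_adj_none_left] at hce
      subst hce
      exact absurd (WithBot.coe_lt_coe.1 hlt₂) (hv a).not_gt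
    · rcases b with _ | b
      · exact absurd hlt₁ not_lt_bot
      rcases e with _ | e
      · exact absurd hlt₂ not_lt_bot
      rw [pendant_adj_some_some] at hab hce
      exact (h.eq_or_eq hab hce (WithBot.coe_lt_coe.1 hlt₁) (WithBot.coe_lt_coe.1 hlt₂)
        (WithBot.coe_lt_coe.1 hlt₃) (WithBot.coe_lt_coe.1 hlt₄)).imp
        (congrArg some) (congrArg some)

end Layout

section Distance

variable {V : Type*} {G : SimpleGraph V} {v₀ a b : V}

theorem exists_adj_dist_eq (hG : G.Connected) {n : ℕ} (h : G.dist v₀ a = n + 1) :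
    ∃ b, G.Adj a b ∧ G.dist v₀ b = n := by
  obtain ⟨q, hq⟩ := hG.exists_walk_length_eq_dist a v₀
  rw [SimpleGraph.dist_comm, h] at hq
  cases q with
  | nil => simp at hq
  | @cons _ b _ hab q =>
    refine ⟨b, hab, ?_⟩
    have hle : G.dist v₀ b ≤ n := by
      rw [SimpleGraph.dist_comm]
      exact (SimpleGraph.dist_le q).trans (by simpa using hq.le)
    have htriangle : G.dist v₀ a ≤ G.dist v₀ b + G.dist b a := hG.dist_triangle
    have hone : G.dist b a = 1 := SimpleGraph.dist_eq_one_iff_adj.2 hab.symm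
    omega

theorem dist_eq_add_one_of_adj (hG : G.Connected) {t : ℕ} (hab : G.Adj a b)
    (ha : G.dist v₀ a ≤ t) (hb : t < G.dist v₀ b) : G.dist v₀ a = t ∧ G.dist v₀ b = t + 1 := by
  have htriangle : G.dist v₀ b ≤ G.dist v₀ a + G.dist a b := hG.dist_triangle
  have hone : G.dist a b = 1 := SimpleGraph.dist_eq_one_iff_adj.2 hab
  omega

theorem dist_injective_of_forall_adj (hG : G.Connected)
    (h₁ : ∀ a b, G.Adj v₀ a → G.Adj v₀ b → a = b)
    (h₂ : ∀ k a b c, G.Adj k a → G.Adj k b → G.Adj k c → a = b ∨ a = c ∨ b = c) :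
    Function.Injective (G.dist v₀) := by
  suffices h : ∀ n a b, G.dist v₀ a = n → G.dist v₀ b = n → a = b from
    fun a b hab => h _ a b rfl hab.symm
  intro n
  induction n with
  | zero =>
    intro a b ha hb
    rw [← hG.dist_eq_zero_iff.1 ha, ← hG.dist_eq_zero_iff.1 hb]
  | succ n ih =>
    intro a b ha hb
    obtain ⟨a', haa', ha'⟩ := exists_adj_dist_eq hG ha
    obtain ⟨b', hbb', hb'⟩ := exists_adj_dist_eq hG hb
    obtain rfl := ih a' b' ha' hb'
    cases n with
    | zero =>
      obtain rfl := hG.dist_eq_zero_iff.1 ha'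
      exact h₁ _ _ haa'.symm hbb'.symm
    | succ m =>
      obtain ⟨c, hac, hc⟩ := exists_adj_dist_eq hG ha'
      have hca : a ≠ c := by rintro rfl; omega
      have hcb : b ≠ c := by rintro rfl; omega
      exact ((h₂ _ _ _ _ haa'.symm hbb'.symm hac).resolve_right (by tauto))

end Distance

namespace Circuit

variable {C : Circuit}

theorem isAcyclic_interaction (hC : C.interaction.Connected) : C.interaction.IsAcyclic := by
  have hsub : C.interaction.edgeSet ⊆ Set.range fun i => s(C.fst i, C.snd i) := by
    intro e
    induction e with
    | _ x y =>
      rintro ⟨i, ⟨rfl, rfl⟩ | ⟨rfl, rfl⟩⟩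
      · exact ⟨i, rfl⟩
      · exact ⟨i, Sym2.eq_swap⟩
  have hcard : Nat.card C.interaction.edgeSet ≤ 7 :=
    calc Nat.card C.interaction.edgeSet
        ≤ Nat.card (Set.range fun i => s(C.fst i, C.snd i)) :=
          Nat.card_mono (Set.finite_range _) hsub
      _ ≤ Nat.card (Fin 7) := Finite.card_range_le _
      _ = 7 := Nat.card_fin 7
  refine (SimpleGraph.isTree_iff_connected_and_card.2 ⟨hC, le_antisymm ?_
    hC.card_vert_le_card_edgeSet_add_one⟩).isAcyclic
  rw [Nat.card_fin]
  omega

theorem Branching.exists_two_lt_ncard_longArms (hB : C.Branching) :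
    ∃ w, 2 < (longArms (pendant (pendant C.interaction 7) none) w).ncard := by
  obtain ⟨w, hw⟩ := hB
  have hsub : (some ∘ some) '' {x | C.LongArm w x} ⊆
      longArms (pendant (pendant C.interaction 7) none) (some (some w)) := by
    rintro _ ⟨x, ⟨hwx, rfl | ⟨y, hyw, hxy⟩⟩, rfl⟩
    · exact ⟨by simpa using hwx, some none, by simp, by simp⟩
    · exact ⟨by simpa using hwx, some (some y), by simpa using hyw, by simpa using hxy⟩
  have hcard : ((some ∘ some) '' {x | C.LongArm w x}).ncard = {x | C.LongArm w x}.ncard :=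
    Set.ncard_image_of_injective _ ((Option.some_injective _).comp (Option.some_injective _))
  refine ⟨some (some w), ?_⟩
  split_ifs at hw with h7
  · have hmem : some none ∈ longArms (pendant (pendant C.interaction 7) none)
        (some (some w)) := ⟨by simpa using h7, none, by simp, by simp⟩
    have := Set.ncard_le_ncard (Set.insert_subset hmem hsub)
    rw [Set.ncard_insert_of_notMem (by simp)] at this
    omega
  · have := Set.ncard_le_ncard hsub
    omega

theorem Branching.not_isThinLayout (hB : C.Branching) (hC : C.interaction.Connected)
    {α : Type*} [LinearOrder α] {pos : Fin 8 → α} (hpos : ∀ u, pos 7 ≤ pos u) :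
    ¬ IsThinLayout C.interaction pos := by
  intro h
  obtain ⟨w, hw⟩ := hB.exists_two_lt_ncard_longArms
  have hfree : C.interaction.CliqueFree 3 := (isAcyclic_interaction hC).cliqueFree le_rfl
  have hext := (h.pendant hpos).pendant (v := none) fun _ => bot_le
  exact hw.not_ge (hext.ncard_longArms_le_two
    (cliqueFree_three_pendant (cliqueFree_three_pendant hfree 7) none) w)

theorem connected_layeredCircuit : layeredCircuit.interaction.Connected := by
  have hadj : ∀ i, layeredCircuit.interaction.Adj (layeredCircuit.fst i) (layeredCircuit.snd i) :=
    fun i => ⟨i, .inl ⟨rfl, rfl⟩⟩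
  have h3 : layeredCircuit.interaction.Reachable 3 7 := (hadj 6).reachable
  have h5 : layeredCircuit.interaction.Reachable 5 7 := (hadj 5).reachable
  have h1 : layeredCircuit.interaction.Reachable 1 7 := (hadj 4).reachable.trans h3
  have h : ∀ v, layeredCircuit.interaction.Reachable v 7 := by
    intro v
    fin_cases v
    exacts [(hadj 0).reachable.trans h1, h1, (hadj 1).reachable.trans h3, h3,
      (hadj 2).reachable.trans h5, h5, (hadj 3).reachable, .rfl]
  exact ⟨fun u v => (h u).trans (h v).symm⟩

theorem branching_layeredCircuit : layeredCircuit.Branching := by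
  refine ⟨7, ?_⟩
  have h : ({3, 5} : Set (Fin 8)) ⊆ {x | layeredCircuit.LongArm 7 x} := by
    rintro x (rfl | rfl)
    · exact ⟨⟨6, .inr ⟨rfl, rfl⟩⟩, .inr ⟨1, by decide, ⟨4, .inr ⟨rfl, rfl⟩⟩⟩⟩
    · exact ⟨⟨5, .inr ⟨rfl, rfl⟩⟩, .inr ⟨4, by decide, ⟨2, .inr ⟨rfl, rfl⟩⟩⟩⟩
  have := Set.ncard_le_ncard h (Set.toFinite _)
  rw [Set.ncard_pair (by decide)] at this
  rw [if_pos rfl]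
  omega

end Circuit

section Support

variable {N : ℕ}

namespace Distribution

variable {D : Distribution N}

open Classical in
theorem two_pow_card_le_card_local {k : Fin N} {s : Finset (Fin N)}
    (hs : ∀ l ∈ s, D.graph.Adj k l) : 2 ^ s.card ≤ Fintype.card (D.Local k) :=
  (Finset.pow_card_le_prod _ _ _ fun l hl => D.two_le_dim (hs l hl)).trans
    (D.prod_dim_le_card_local s hs)

section CutDim

variable {p : Fin N → Prop} [DecidablePred p]

theorem cutDim_eq_one (h : ∀ x y, D.graph.Adj x y → p x → p y) : D.cutDim p = 1 := by
  classical
  rw [cutDim, Finset.filter_false_of_mem, Finset.prod_empty]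
  exact fun e _ => not_not.2 ⟨h _ _ e.2.2, h _ _ e.2.2.symm⟩

theorem cutDim_le_dim {a b : Fin N} (hab : D.graph.Adj a b)
    (h : ∀ x y, D.graph.Adj x y → p x → ¬ p y → x = a ∧ y = b) :
    D.cutDim p ≤ D.dim a b := by
  classical
  have hcross : ∀ e : D.Edge, ¬(p e.1.1 ↔ p e.1.2) → e.1 = (a, b) ∨ e.1 = (b, a) := by
    intro e he
    by_cases h₁ : p e.1.1
    · exact .inl (Prod.ext_iff.2 (h _ _ e.2.2 h₁ fun h₂ => he (iff_of_true h₁ h₂)))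
    · have h₂ : p e.1.2 := by tauto
      exact .inr (Prod.ext_iff.2 (h _ _ e.2.2.symm h₂ h₁).symm)
  rw [cutDim]
  rcases (Finset.univ.filter fun e : D.Edge => ¬(p e.1.1 ↔ p e.1.2)).eq_empty_or_nonempty
    with hempty | ⟨e, he⟩
  · rw [hempty, Finset.prod_empty]
    exact one_le_two.trans (D.two_le_dim hab)
  · have hsingle : (Finset.univ.filter fun e : D.Edge => ¬(p e.1.1 ↔ p e.1.2)) = {e} := by
      refine Finset.eq_singleton_iff_unique_mem.2 ⟨he, fun e' he' => Subtype.ext ?_⟩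
      rcases hcross e (Finset.mem_filter.1 he).2 with h₁ | h₁ <;>
        rcases hcross e' (Finset.mem_filter.1 he').2 with h₂ | h₂ <;> grind [e.2.1, e'.2.1]
    rw [hsingle, Finset.prod_singleton]
    rcases hcross e (Finset.mem_filter.1 he).2 with h₁ | h₁ <;> rw [h₁]
    · exact min_le_left _ _
    · exact min_le_right _ _

end CutDim

/-- The dimensions of the edges of `D` allow, across every cut, the Schmidt rank of entangled
qubit pairs along any matching of `G` across this cut. -/
def Supports (D : Distribution N) (G : SimpleGraph (Fin N)) : Prop :=
  ∀ (p : Fin N → Prop) [DecidablePred p] {m : ℕ} (a b : Fin m → Fin N),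
    IsCutMatching G p a b → 2 ^ m ≤ D.cutDim p

variable {G : SimpleGraph (Fin N)} {v₀ : Fin N}

theorem Supports.connected (hD : D.Supports G) (hG : G.Connected) : D.graph.Connected := by
  classical
  have hreach : ∀ u v, D.graph.Reachable u v := by
    by_contra! hunreach
    obtain ⟨u, v, huv⟩ := hunreach
    obtain ⟨q⟩ := hG.preconnected u v
    obtain ⟨g, -, hfst, hsnd⟩ := q.exists_boundary_dart {x | D.graph.Reachable u x} .rfl huv
    have htwo := hD (D.graph.Reachable u) _ _ (.single g.adj hfst hsnd)
    rw [D.cutDim_eq_one fun x y hxy hx => hx.trans hxy.reachable] at htwo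
    exact absurd htwo (by decide)
  exact { preconnected := hreach, nonempty := hG.nonempty }

section Path

variable (hconn : D.graph.Connected)

include hconn

open Classical in
theorem dist_injective (h₀ : Fintype.card (D.Local v₀) < 4)
    (hd : ∀ k, Fintype.card (D.Local k) < 8) : Function.Injective (D.graph.dist v₀) := by
  refine dist_injective_of_forall_adj hconn (fun a b ha hb => ?_) fun k a b c ha hb hc => ?_
  · by_contra hab
    have hfour := D.two_pow_card_le_card_local (k := v₀) (s := {a, b}) (by simp [ha, hb])
    rw [Finset.card_pair hab] at hfour
    omega
  · by_contra! hne
    have eight_le := D.two_pow_card_le_card_local (k := k) (s := {a, b, c}) (by simp [ha, hb, hc])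
    rw [Finset.card_eq_three.2 ⟨a, b, c, hne.1, hne.2.1, hne.2.2, rfl⟩] at eight_le
    exact absurd (eight_le.trans_lt (hd k)) (by decide)

open Classical in
theorem dim_lt_four_of_dist_lt (h₀ : Fintype.card (D.Local v₀) < 4)
    (hd : ∀ k, Fintype.card (D.Local k) < 8) {a b : Fin N} (hab : D.graph.Adj a b)
    (hlt : D.graph.dist v₀ a < D.graph.dist v₀ b) : D.dim a b < 4 := by
  cases hdist : D.graph.dist v₀ a with
  | zero =>
    obtain rfl := hconn.dist_eq_zero_iff.1 hdist
    have hle := D.prod_dim_le_card_local {b} (by simpa using hab)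
    rw [Finset.prod_singleton] at hle
    omega
  | succ n =>
    obtain ⟨c, hac, hc⟩ := exists_adj_dist_eq hconn hdist
    have hbc : b ≠ c := by rintro rfl; omega
    have hle := D.prod_dim_le_card_local (k := a) {b, c} (by simp [hab, hac])
    rw [Finset.prod_pair hbc] at hle
    have htwo := Nat.mul_le_mul_left (D.dim a b) (D.two_le_dim hac)
    have := hd a
    omega

open Classical in
theorem cutDim_dist_le_lt_four (h₀ : Fintype.card (D.Local v₀) < 4)
    (hd : ∀ k, Fintype.card (D.Local k) < 8) (t : ℕ) :
    D.cutDim (fun v => D.graph.dist v₀ v ≤ t) < 4 := by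
  by_cases hcross : ∃ a b, D.graph.Adj a b ∧ D.graph.dist v₀ a ≤ t ∧ t < D.graph.dist v₀ b
  · obtain ⟨a, b, hab, ha, hb⟩ := hcross
    refine (D.cutDim_le_dim hab fun x y hxy hx hy => ?_).trans_lt
      (dim_lt_four_of_dist_lt hconn h₀ hd hab (ha.trans_lt hb))
    obtain ⟨hat, hbt⟩ := dist_eq_add_one_of_adj hconn hab ha hb
    obtain ⟨hxt, hyt⟩ := dist_eq_add_one_of_adj hconn hxy hx (not_le.1 hy)
    have hinj := dist_injective hconn h₀ hd
    exact ⟨hinj (hxt.trans hat.symm), hinj (hyt.trans hbt.symm)⟩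
  · push Not at hcross
    rw [D.cutDim_eq_one hcross]
    decide

end Path

open Classical in
theorem Supports.isThinLayout_dist (hD : D.Supports G) (hG : G.Connected)
    (h₀ : Fintype.card (D.Local v₀) < 4) (hd : ∀ k, Fintype.card (D.Local k) < 8) :
    IsThinLayout G (D.graph.dist v₀) where
  injective := dist_injective (hD.connected hG) h₀ hd
  eq_or_eq a b c e hab hce hlt₁ hlt₂ hlt₃ hlt₄ := by
    by_contra! hne
    set t := max (D.graph.dist v₀ a) (D.graph.dist v₀ c)
    have hfour := hD (fun v => D.graph.dist v₀ v ≤ t) _ _ (.pair hab hce (le_max_left _ _)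
      (le_max_right _ _) (max_lt hlt₁ hlt₃).not_ge (max_lt hlt₂ hlt₄).not_ge hne.1 hne.2)
    exact (cutDim_dist_le_lt_four (hD.connected hG) h₀ hd t).not_ge hfour

end Distribution

open Classical in
theorem ConsistsOfBipartite.exists_supports {d : Fin N → ℕ} {φ : Conf d → ℂ}
    (hφ : ConsistsOfBipartite φ) {S : Set (Conf d → ℂ)} (hres : IsCommonResource φ S)
    {G : SimpleGraph (Fin N)} (hS : EntanglesMatchings G S) :
    ∃ D : Distribution N, (∀ k, Fintype.card (D.Local k) ≤ d k) ∧ D.Supports G := by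
  obtain ⟨D, W, hW, hφ⟩ := hφ
  have hφ : φ = piKronecker W *ᵥ D.amplitude := funext hφ
  refine ⟨D, fun k => D.card_local_le (hW k), fun p _ m a b hab => ?_⟩
  obtain ⟨ψ, hψ, hrank⟩ := hS p a b hab
  calc 2 ^ m ≤ cutRank p ψ := hrank
    _ ≤ cutRank p φ := (hres ψ hψ).cutRank_le p
    _ ≤ cutRank p D.amplitude := hφ ▸ cutRank_piKronecker_mulVec_le p W _
    _ ≤ D.cutDim p := D.cutRank_amplitude_le_cutDim p

theorem exists_isThinLayout {d : Fin N → ℕ} {φ : Conf d → ℂ} (hφ : ConsistsOfBipartite φ)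
    {S : Set (Conf d → ℂ)} (hres : IsCommonResource φ S) {G : SimpleGraph (Fin N)}
    (hS : EntanglesMatchings G S) (hG : G.Connected) (hd : ∀ k, d k < 8) {v₀ : Fin N}
    (h₀ : d v₀ < 4) : ∃ pos : Fin N → ℕ, IsThinLayout G pos ∧ ∀ u, pos v₀ ≤ pos u := by
  classical
  obtain ⟨D, hcard, hD⟩ := hφ.exists_supports hres hS
  refine ⟨D.graph.dist v₀, hD.isThinLayout_dist hG ((hcard v₀).trans_lt h₀)
    fun k => (hcard k).trans_lt (hd k), fun u => ?_⟩
  rw [SimpleGraph.dist_self]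
  exact Nat.zero_le _

end Support

end BipartiteResource

end

theorem proposition2_general {d : Fin 8 → ℕ} (h2 : ∀ k, 2 ≤ d k) (h8 : ∀ k, d k < 8)
    (h7 : d 7 < 4) (C : BipartiteResource.Circuit) (hC : C.interaction.Connected)
    (hB : C.Branching) :
    ¬ BipartiteResource.AchievableByBipartite d (BipartiteResource.embed '' C.outputs) := by
  rintro ⟨φ, -, hφ, hres⟩
  obtain ⟨pos, hpos, hleast⟩ := BipartiteResource.exists_isThinLayout hφ hres
    (C.entanglesMatchings_outputs.image_embed h2) hC h8 h7
  exact hB.not_isThinLayout hC hleast hpos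

theorem proposition2 :
    ¬ BipartiteResource.AchievableByBipartite BipartiteResource.d₀
        (BipartiteResource.targetSet BipartiteResource.layeredCircuit) ∧
    ∀ C : BipartiteResource.Circuit, C.interaction.Connected → C.Branching →
      ¬ BipartiteResource.AchievableByBipartite BipartiteResource.d₀
        (BipartiteResource.targetSet C) := by
  have key := proposition2_general (d := BipartiteResource.d₀) (by decide)
    (by decide) (by decide)
  exact ⟨key _ BipartiteResource.Circuit.connected_layeredCircuit
    BipartiteResource.Circuit.branching_layeredCircuit, key⟩
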